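/- Fix integers $k,d$. An \emph{object} is a closed topological disk in $\mathbb R^2$ whose boundary is composed of at most $k$ (weakly) $x$-monotone arcs that meet only at common endpoints, each arc lying on the zero set of a nonzero bivariate real polynomial of degree at most $d$; the endpoints of the arcs are the vertices of the object. There is a constant $C=C(k,d)>0$ such that the following holds for every $n\ge 2$. Let $\mathcal D$ be a set of $n$ objects in general position: for any two distinct objects, their boundaries have finitely many common points and cross properly (topologically) at each of them, and no point lies on the boundaries of three objects. Let $U:\mathbb N\to\mathbb R$ be such that for every subset $\mathcal D'\subseteq\mathcal D$ the boundary of $\bigcup\mathcal D'$ has at most $U(|\mathcal D'|)$ vertices and edges in total (its vertices are the vertices of objects of $\mathcal D'$ and the intersection points of two boundaries of objects of $\mathcal D'$ that lie on it), and such that $U$ is at least linear in the sense that $U(a)+U(b)\le U(a+b)$ for all $a,b\ge 1$. Let $\pi$ be a uniformly random permutation, let $D_1,\dots,D_n$ be the objects in the order given by $\pi$, and let $F$ be the set of faces of the stacking: the closures of the connected components of the sets $\mathrm{int}(D_i)\setminus\bigcup_{j>i}D_j$, $1\le i\le n$. For $f\in F$ let $K_f=\{D\in\mathcal D:\partial D\cap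 f\ne\emptyset\}$, and let $K^*_f$ be the set of points $p$ that are a proper intersection of $\partial D$ and $\partial f$ for some $D\in\mathcal D$, that is, $p\in\partial D\cap\partial f$ and $\partial D$ enters the interior of $f$ at $p$ (so $p$ is in the closure of $\partial D\cap\mathrm{int}(f)$). Then $$\mathbb E\Big[\sum_{f\in F}|K^*_f|\Big]\le C\,U(n)\log n\qquad\text{and}\qquad \mathbb E\Big[\sum_{f\in F}|K_f|\Big]\le C\,U(n)\log n .$$ -/

import Mathlib

open scoped ENNReal

namespace RandomStacking

/-- The Euclidean plane. -/
abbrev Plane : Type := EuclideanSpace ℝ (Fin 2)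

/-- An `x`-monotone Jordan arc lying on the zero set of a nonzero bivariate real polynomial of
total degree at most `d`.  Monotonicity is weak, so that vertical segments are allowed. -/
structure Arc (d : ℕ) where
  param : unitInterval → Plane
  continuous_param : Continuous param
  injective_param : Function.Injective param
  xMonotone : Monotone fun t => param t 0
  algebraic : ∃ q : MvPolynomial (Fin 2) ℝ, q ≠ 0 ∧ q.totalDegree ≤ d ∧
    ∀ t, MvPolynomial.eval (fun j => param t j) q = 0

/-- The arc as a set of points, endpoints included. -/
def Arc.carrier {d : ℕ} (e : Arc d) : Set Plane := Set.range e.param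

/-- The two endpoints of an arc. -/
def Arc.endpoints {d : ℕ} (e : Arc d) : Set Plane := {e.param 0, e.param 1}

/-- An object: a closed topological disk whose boundary is composed of at most `k` arcs of
degree at most `d`, any two of which meet at common endpoints only.  A topological disk is the
image of the closed unit disk under a homeomorphism of the plane; by the Jordan-Schoenflies
theorem these are all the subsets of the plane that are homeomorphic to the closed unit disk. -/
structure Object (k d : ℕ) where
  carrier : Set Plane
  isDisk : ∃ h : Plane ≃ₜ Plane, h '' Metric.closedBall 0 1 = carrier
  numArcs : ℕ
  numArcs_le : numArcs ≤ k
  arc : Fin numArcs → Arc d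
  frontier_eq : frontier carrier = ⋃ a, (arc a).carrier
  arc_inter : ∀ a b, a ≠ b →
    (arc a).carrier ∩ (arc b).carrier ⊆ (arc a).endpoints ∩ (arc b).endpoints

/-- The vertices of an object: the endpoints of its boundary arcs. -/
def Object.vertices {k d : ℕ} (X : Object k d) : Set Plane := ⋃ a, (X.arc a).endpoints

/-- The curves `A` and `B` cross properly at `p`: in suitable local coordinates around `p`
they are the two coordinate axes. -/
def CrossProperlyAt (A B : Set Plane) (p : Plane) : Prop :=
  ∃ φ : OpenPartialHomeomorph Plane Plane, p ∈ φ.source ∧ φ p = 0 ∧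
    ∀ x ∈ φ.source, (x ∈ A ↔ φ x 0 = 0) ∧ (x ∈ B ↔ φ x 1 = 0)

/-- General position: the boundaries of two distinct objects have finitely many common points,
at each of which they cross properly, and no point lies on the boundaries of three objects. -/
structure GeneralPosition {k d n : ℕ} (D : Fin n → Object k d) : Prop where
  finite_inter : ∀ i j, i ≠ j →
    (frontier (D i).carrier ∩ frontier (D j).carrier).Finite
  cross : ∀ i j, i ≠ j → ∀ p ∈ frontier (D i).carrier ∩ frontier (D j).carrier,
    CrossProperlyAt (frontier (D i).carrier) (frontier (D j).carrier) p
  no_three : ∀ i j l, i ≠ j → i ≠ l → j ≠ l →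
    frontier (D i).carrier ∩ frontier (D j).carrier ∩ frontier (D l).carrier = ∅

/-- The union of the objects with index in `S`. -/
def unionOf {k d n : ℕ} (D : Fin n → Object k d) (S : Finset (Fin n)) : Set Plane :=
  ⋃ i ∈ S, (D i).carrier

/-- The vertices of the union of the objects with index in `S`: the points of its boundary that
are a vertex of one of the objects or a common boundary point of two of them. -/
def unionVertices {k d n : ℕ} (D : Fin n → Object k d) (S : Finset (Fin n)) : Set Plane :=
  {p ∈ frontier (unionOf D S) | (∃ i ∈ S, p ∈ (D i).vertices) ∨
    ∃ i ∈ S, ∃ j ∈ S, i ≠ j ∧ p ∈ frontier (D i).carrier ∩ frontier (D j).carrier}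

/-- The (relatively open) edges of the union of the objects with index in `S`: the connected
pieces into which the vertices cut the parts of boundary arcs that lie on its boundary. -/
def unionEdges {k d n : ℕ} (D : Fin n → Object k d) (S : Finset (Fin n)) : Set (Set Plane) :=
  {c | ∃ i ∈ S, ∃ a,
    ∃ x ∈ ((((D i).arc a).carrier ∩ frontier (unionOf D S)) \ unionVertices D S),
      c = connectedComponentIn
        ((((D i).arc a).carrier ∩ frontier (unionOf D S)) \ unionVertices D S) x}

/-- The combinatorial complexity of the union of the objects with index in `S`: its number of
vertices plus its number of edges. -/
noncomputable def unionComplexity {k d n : ℕ} (D : Fin n → Object k d) (S : Finset (Fin n)) :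
    ℕ∞ :=
  (unionVertices D S).encard + (unionEdges D S).encard

/-- `D` has union complexity `U`: for every subset of `m` of the objects, the union has
combinatorial complexity at most `U m`. -/
def HasUnionComplexity {k d n : ℕ} (D : Fin n → Object k d) (U : ℕ → ℝ) : Prop :=
  ∀ S : Finset (Fin n), (unionComplexity D S : ℝ≥0∞) ≤ ENNReal.ofReal (U S.card)

/-- The part of the interior of the `i`-th object drawn that stays visible when the objects
`D (π 0), D (π 1), …` are drawn in this order, each on top of the previous ones. -/
def visiblePart {k d n : ℕ} (D : Fin n → Object k d) (π : Equiv.Perm (Fin n)) (i : Fin n) :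
    Set Plane :=
  interior (D (π i)).carrier \ ⋃ j, ⋃ (_ : i < j), (D (π j)).carrier

/-- The (closed) faces of the stacking of `D` in the order `π`: the closures of the connected
components of the visible parts. -/
def faces {k d n : ℕ} (D : Fin n → Object k d) (π : Equiv.Perm (Fin n)) : Set (Set Plane) :=
  {f | ∃ i, ∃ x ∈ visiblePart D π i, f = closure (connectedComponentIn (visiblePart D π i) x)}

/-- The conflict list of a face `f`: the (indices of the) objects whose boundary meets `f`. -/
def conflictList {k d n : ℕ} (D : Fin n → Object k d) (f : Set Plane) : Set (Fin n) :=
  {i | (frontier (D i).carrier ∩ f).Nonempty}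

/-- The proper intersections of object boundaries with the boundary of a face `f`: the common
points of `∂f` and some `∂D i` at which `∂D i` enters the interior of `f`. -/
def properIntersections {k d n : ℕ} (D : Fin n → Object k d) (f : Set Plane) : Set Plane :=
  {p | ∃ i, p ∈ frontier (D i).carrier ∩ frontier f ∧
    p ∈ closure (frontier (D i).carrier ∩ interior f)}

/-- The expectation of `X π` for a uniformly random permutation `π` of `n` elements. -/
noncomputable def expectation {n : ℕ} (X : Equiv.Perm (Fin n) → ℝ≥0∞) : ℝ≥0∞ :=
  (∑ π, X π) / (n.factorial : ℝ≥0∞)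

end RandomStacking

/-! ### Weighted samples that contain two given elements and avoid others. -/

namespace RandomStacking

open Finset

/-! Everything reduces to counting crossings, the common boundary points of two objects. For a
crossing q let B be the two objects with q on their boundary and M the objects with q in their
interior; q is exposed if some object of B is drawn after all of M. Proper intersections on a face
are exposed crossings, and a boundary meeting a face either lies inside the face or has an exposed
crossing in it (`properIntersections_subset`, `subset_or_exists_exposed`). A point on a boundary
lies in at most four faces, so both sums are O(n + number of exposed crossings).

By symmetry q is exposed with probability at most 2/(|M|+1) (`card_exposed_le`). The number
1/(|M|+1) is exactly the total weight of the samples S with B ⊆ S and S ∩ M = ∅, for a weight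
depending only on |S| (`sum_sampleWeight`). For each such S, q is a vertex of the union of S
(`GeneralPosition.mem_unionVertices`), so a sample of size m accounts for at most U(m) crossings.
Summing over all samples gives ∑ n U(m)/(m(m-1)), and superadditivity, in the form n U(m) ≤ 2m U(n),
turns this into U(n) times a harmonic sum. -/

/-- The binomial identity behind the average of an avoidance probability over all sample sizes. -/
theorem sum_choose_div_choose {N l : ℕ} (h : l ≤ N) :
    ∑ j ∈ range (N - l + 1), ((N - l).choose j : ℝ) / N.choose j = (N + 1) / (l + 1) := by
  have hl : (N.choose l : ℝ) ≠ 0 := by exact_mod_cast (Nat.choose_pos h).ne'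
  have key : ∀ j ∈ range (N - l + 1),
      ((N - l).choose j : ℝ) / N.choose j = ((N - j).choose l : ℝ) / N.choose l := by
    intro j hj
    have hj' : j ≤ N - l := Nat.lt_succ_iff.1 (mem_range.1 hj)
    have hj0 : (N.choose j : ℝ) ≠ 0 := by
      exact_mod_cast (Nat.choose_pos (by omega : j ≤ N)).ne'
    rw [div_eq_div_iff hj0 hl]
    -- Disjoint pairs of an l-set and a j-set, counted by their union, then by either set first.
    have h1 := Nat.choose_mul (n := N) (k := l + j) (s := l) (by omega)
    have h2 := Nat.choose_mul (n := N) (k := l + j) (s := j) (by omega)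
    rw [Nat.add_sub_cancel_left] at h1
    rw [Nat.add_sub_cancel, ← Nat.choose_symm_add] at h2
    have h3 : N.choose l * (N - l).choose j = N.choose j * (N - j).choose l := h1.symm.trans h2
    have h4 : (N.choose l : ℝ) * (N - l).choose j = N.choose j * (N - j).choose l := by
      exact_mod_cast h3
    linarith
  rw [sum_congr rfl key, ← sum_div]
  have hs : ∑ j ∈ range (N - l + 1), (N - j).choose l = (N + 1).choose (l + 1) := by
    rw [← Nat.sum_Icc_choose]
    refine sum_bij' (fun j _ => N - j) (fun i _ => N - i) ?_ ?_ ?_ ?_ ?_ <;>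
      simp only [mem_range, mem_Icc] <;> intros <;> first | omega | trivial
  rw [← Nat.cast_sum, hs]
  have h5 : ((N + 1 : ℕ) : ℝ) * N.choose l = (N + 1).choose (l + 1) * ((l + 1 : ℕ) : ℝ) := by
    exact_mod_cast Nat.add_one_mul_choose_eq N l
  rw [div_eq_div_iff hl (by positivity)]
  push_cast at h5
  linarith

/-- The weight of a subset of size `m` of a set of size `n`. -/
noncomputable def sampleWeight (n m : ℕ) : ℝ := n / (m * (m - 1) * n.choose m)

theorem sampleWeight_nonneg (n m : ℕ) : 0 ≤ sampleWeight n m := by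
  unfold sampleWeight
  rcases Nat.eq_zero_or_pos m with rfl | hm
  · simp
  · have : (1 : ℝ) ≤ m := by exact_mod_cast hm
    have : (0 : ℝ) ≤ m - 1 := by linarith
    positivity

/-- Outside the given pair, the weight is a probability: draw a size j uniformly from 0, …, N, then
a uniform j-subset of the N remaining elements. -/
theorem sampleWeight_add_two (N j : ℕ) :
    sampleWeight (N + 2) (j + 2) = 1 / ((N + 1) * N.choose j) := by
  unfold sampleWeight
  have h1 : ((N + 2 : ℕ) : ℝ) * (N + 1).choose (j + 1)
      = (N + 2).choose (j + 2) * ((j + 2 : ℕ) : ℝ) := by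
    exact_mod_cast Nat.add_one_mul_choose_eq (N + 1) (j + 1)
  have h2 : ((N + 1 : ℕ) : ℝ) * N.choose j = (N + 1).choose (j + 1) * ((j + 1 : ℕ) : ℝ) := by
    exact_mod_cast Nat.add_one_mul_choose_eq N j
  push_cast at h1 h2 ⊢
  have h3 : ((j : ℝ) + 2) * (j + 2 - 1) * (N + 2).choose (j + 2)
      = (N + 2) * ((N + 1) * N.choose j) := by
    rw [h2]
    linear_combination (-(j + 1 : ℝ)) * h1
  rw [h3, ← div_div, div_self (by positivity)]

/-- The total weight of the samples that contain two given elements and avoid `l` others. -/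
theorem sum_sampleWeight {n : ℕ} {B M : Finset (Fin n)} (hB : #B = 2) (hBM : Disjoint B M) :
    ∑ S ∈ Icc B Mᶜ, sampleWeight n #S = 1 / (#M + 1) := by
  have hsub : B ⊆ Mᶜ := by
    intro x hx
    exact mem_compl.2 (disjoint_left.1 hBM hx)
  have hcard : #B + #M ≤ n := by
    rw [← card_union_of_disjoint hBM]
    simpa using card_le_univ (B ∪ M)
  obtain ⟨N, rfl⟩ : ∃ N, n = N + 2 := ⟨n - 2, by omega⟩
  have hdiff : #(Mᶜ \ B) = N - #M := by
    rw [card_sdiff_of_subset hsub, card_compl, Fintype.card_fin]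
    omega
  have hinj : Set.InjOn (B ∪ ·) ((Mᶜ \ B).powerset : Set (Finset (Fin (N + 2)))) := by
    intro s hs t ht hst
    have hs' : Disjoint B s :=
      disjoint_right.2 fun x hx => (mem_sdiff.1 (mem_powerset.1 (mem_coe.1 hs) hx)).2
    have ht' : Disjoint B t :=
      disjoint_right.2 fun x hx => (mem_sdiff.1 (mem_powerset.1 (mem_coe.1 ht) hx)).2
    have := congrArg (· \ B) hst
    simpa [union_sdiff_left, sdiff_eq_self_of_disjoint hs'.symm,
      sdiff_eq_self_of_disjoint ht'.symm] using this
  rw [Icc_eq_image_powerset hsub, sum_image hinj]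
  have hterm : ∀ T ∈ (Mᶜ \ B).powerset,
      sampleWeight (N + 2) #(B ∪ T) = 1 / ((N + 1) * N.choose #T) := by
    intro T hT
    have hT' : Disjoint B T :=
      disjoint_right.2 fun x hx => (mem_sdiff.1 (mem_powerset.1 hT hx)).2
    rw [card_union_of_disjoint hT', hB, add_comm 2, sampleWeight_add_two]
  rw [sum_congr rfl hterm, sum_powerset_apply_card (fun m => 1 / ((N + 1 : ℝ) * N.choose m)), hdiff]
  -- In that random model, this is the probability that the sample avoids `M`.
  have h := sum_choose_div_choose (N := N) (l := #M) (by omega)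
  have hN : ((N : ℝ) + 1) ≠ 0 := by positivity
  calc _ = ∑ j ∈ range (N - #M + 1), (1 / (N + 1 : ℝ)) * (((N - #M).choose j : ℝ) / N.choose j) := by
        refine sum_congr rfl fun j _ => ?_
        rw [nsmul_eq_mul, div_mul_div_comm, one_mul, mul_one_div]
    _ = _ := by
        rw [← mul_sum, h]
        field_simp

/-! ### Random orders and the probability of being exposed. -/

/-- The orders in which `c` comes after all other elements of `T`. -/
def lastOrders {n : ℕ} (T : Finset (Fin n)) (c : Fin n) : Finset (Equiv.Perm (Fin n)) :=
  univ.filter fun π => ∀ l ∈ T, l ≠ c → π.symm l < π.symm c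

/-- Exchanging `c` and `c'` in the order is a bijection. -/
theorem card_lastOrders_eq {n : ℕ} {T : Finset (Fin n)} {c c' : Fin n} (hc : c ∈ T)
    (hc' : c' ∈ T) : #(lastOrders T c) = #(lastOrders T c') := by
  have key : ∀ {c c' : Fin n}, c ∈ T → c' ∈ T → ∀ π ∈ lastOrders T c,
      π.trans (Equiv.swap c c') ∈ lastOrders T c' := by
    intro c c' hc hc' π hπ
    simp only [lastOrders, mem_filter, mem_univ, true_and] at hπ ⊢
    intro l hl hlc
    simp only [Equiv.symm_trans_apply, Equiv.symm_swap, Equiv.swap_apply_right]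
    by_cases h : l = c
    · subst h
      rw [Equiv.swap_apply_left]
      exact hπ c' hc' (Ne.symm hlc)
    · rw [Equiv.swap_apply_of_ne_of_ne h hlc]
      exact hπ l hl h
  refine card_bij' (fun π _ => π.trans (Equiv.swap c c')) (fun π _ => π.trans (Equiv.swap c' c))
    (key hc hc') (key hc' hc) ?_ ?_
  · intro π _
    ext x
    simp [Equiv.swap_comm c' c]
  · intro π _
    ext x
    simp [Equiv.swap_comm c' c]

/-- At most one element of `T` can be last, so the `#T` equally large sets of orders are disjoint.
-/
theorem card_mul_card_lastOrders {n : ℕ} {T : Finset (Fin n)} {c : Fin n} (hc : c ∈ T) :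
    #T * #(lastOrders T c) ≤ n.factorial := by
  have hdisj : (T : Set (Fin n)).PairwiseDisjoint (lastOrders T) := by
    intro x hx y hy hxy
    refine disjoint_left.2 fun π h1 h2 => ?_
    simp only [lastOrders, mem_filter, mem_univ, true_and] at h1 h2
    exact lt_asymm (h1 y hy hxy.symm) (h2 x hx hxy)
  calc #T * #(lastOrders T c) = ∑ x ∈ T, #(lastOrders T x) := by
        rw [sum_congr rfl fun x hx => card_lastOrders_eq hx hc, sum_const, smul_eq_mul]
    _ = #(T.biUnion (lastOrders T)) := (card_biUnion hdisj).symm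
    _ ≤ #(univ : Finset (Equiv.Perm (Fin n))) := card_le_univ _
    _ = n.factorial := by rw [card_univ, Fintype.card_perm, Fintype.card_fin]

/-- Some element of `B` comes after all elements of `M` in the order `π`. -/
def Exposed {n : ℕ} (π : Equiv.Perm (Fin n)) (B M : Finset (Fin n)) : Prop :=
  ∃ c ∈ B, ∀ l ∈ M, π.symm l < π.symm c

instance {n : ℕ} (π : Equiv.Perm (Fin n)) (B M : Finset (Fin n)) : Decidable (Exposed π B M) :=
  inferInstanceAs (Decidable (∃ c ∈ B, ∀ l ∈ M, π.symm l < π.symm c))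

theorem card_exposed_le {n : ℕ} {B M : Finset (Fin n)} (hB : #B = 2) (hBM : Disjoint B M) :
    (#(univ.filter fun π : Equiv.Perm (Fin n) => Exposed π B M) : ℝ)
      ≤ 2 * n.factorial * (1 / (#M + 1)) := by
  have hsub : (univ.filter fun π : Equiv.Perm (Fin n) => Exposed π B M)
      ⊆ B.biUnion fun c => lastOrders (insert c M) c := by
    intro π hπ
    obtain ⟨c, hc, h⟩ := (mem_filter.1 hπ).2
    refine mem_biUnion.2 ⟨c, hc, ?_⟩
    simp only [lastOrders, mem_filter, mem_univ, true_and, mem_insert]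
    rintro l (rfl | hl) hne
    · exact absurd rfl hne
    · exact h l hl
  have h1 : ∀ c ∈ B, (#(lastOrders (insert c M) c) : ℝ) ≤ n.factorial * (1 / (#M + 1)) := by
    intro c hc
    have h := card_mul_card_lastOrders (mem_insert_self c M)
    rw [card_insert_of_notMem (disjoint_left.1 hBM hc)] at h
    have h' : ((#M : ℝ) + 1) * #(lastOrders (insert c M) c) ≤ n.factorial := by exact_mod_cast h
    rw [mul_one_div, le_div_iff₀ (by positivity)]
    linarith
  calc (#(univ.filter fun π : Equiv.Perm (Fin n) => Exposed π B M) : ℝ)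
      ≤ ∑ c ∈ B, (#(lastOrders (insert c M) c) : ℝ) := by
        exact_mod_cast (card_le_card hsub).trans card_biUnion_le
    _ ≤ ∑ c ∈ B, n.factorial * (1 / ((#M : ℝ) + 1)) := sum_le_sum h1
    _ = _ := by rw [sum_const, hB, nsmul_eq_mul]; push_cast; ring

theorem sum_one_div_sub_one_le (n : ℕ) (hn : 2 ≤ n) :
    ∑ m ∈ Icc 2 n, 1 / ((m : ℝ) - 1) ≤ 3 * Real.log n := by
  obtain ⟨N, rfl⟩ : ∃ N, n = N + 1 := ⟨n - 1, by omega⟩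
  have h1 : ∑ m ∈ Icc 2 (N + 1), 1 / ((m : ℝ) - 1) = (harmonic N : ℝ) := by
    rw [harmonic_eq_sum_Icc, Rat.cast_sum]
    refine sum_bij' (fun m _ => m - 1) (fun i _ => i + 1) ?_ ?_ ?_ ?_ ?_ <;>
      simp only [mem_Icc] <;> intro m hm
    · omega
    · omega
    · omega
    · omega
    · obtain ⟨i, rfl⟩ : ∃ i, m = i + 1 := ⟨m - 1, by omega⟩
      simp
  rw [h1]
  -- The constant 3 comes from 1 + log n together with 1 ≤ 2 log 2 ≤ 2 log n.
  have h2 := harmonic_le_one_add_log N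
  have hN : (1 : ℝ) ≤ N := by exact_mod_cast (by omega : 1 ≤ N)
  have h3 : Real.log N ≤ Real.log (N + 1 : ℕ) :=
    Real.log_le_log (by linarith) (by push_cast; linarith)
  have h4 : Real.log 2 ≤ Real.log (N + 1 : ℕ) :=
    Real.log_le_log (by norm_num) (by exact_mod_cast hn)
  have := Real.log_two_gt_d9
  linarith

/-! ### Summing a superadditive function over the samples. -/

section Superadditive

variable {U : ℕ → ℝ} (hU : ∀ a b : ℕ, 1 ≤ a → 1 ≤ b → U a + U b ≤ U (a + b))
include hU

theorem mul_le_of_superadditive {m q : ℕ} (hm : 1 ≤ m) (hq : 1 ≤ q) : q * U m ≤ U (q * m) := by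
  induction q, hq using Nat.le_induction with
  | base => simp
  | succ q hq ih =>
    have := hU (q * m) m (Nat.mul_pos hq hm) hm
    rw [add_mul, one_mul]
    push_cast
    linarith

theorem le_of_superadditive (h1 : 1 ≤ U 1) {m : ℕ} (hm : 1 ≤ m) : (m : ℝ) ≤ U m := by
  have h := mul_le_of_superadditive hU le_rfl hm
  rw [mul_one] at h
  have : (0 : ℝ) ≤ m := by positivity
  nlinarith

/-- The quotient ⌊n/m⌋ is at least n/(2m), and that many blocks of size `m` fit into `n`. -/
theorem le_ratio_of_superadditive (h1 : 1 ≤ U 1) {m n : ℕ} (hm : 1 ≤ m) (hmn : m ≤ n) :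
    n * U m ≤ 2 * m * U n := by
  have hq : 1 ≤ n / m := Nat.div_pos hmn hm
  have h2 := mul_le_of_superadditive hU hm hq
  have h3 : U (n / m * m) ≤ U n := by
    -- Superadditivity holds for positive arguments only and says nothing about `U 0`.
    rcases Nat.eq_zero_or_pos (n % m) with h | h
    · have := Nat.div_add_mod' n m
      rw [h, add_zero] at this
      rw [this]
    · have h4 := hU (n / m * m) (n % m) (Nat.mul_pos hq hm) h
      rw [Nat.div_add_mod'] at h4
      have h5 := le_of_superadditive hU h1 h
      have : (0 : ℝ) ≤ (n % m : ℕ) := by positivity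
      linarith
  have h6 : n ≤ 2 * m * (n / m) := by
    have := Nat.div_add_mod n m
    have := Nat.mod_lt n hm
    nlinarith
  have h7 : (n : ℝ) ≤ 2 * m * (n / m : ℕ) := by exact_mod_cast h6
  have h8 := le_of_superadditive hU h1 hm
  have h9 : (0 : ℝ) ≤ U m := le_trans (by positivity) h8
  calc (n : ℝ) * U m ≤ 2 * m * (n / m : ℕ) * U m := mul_le_mul_of_nonneg_right h7 h9
    _ = 2 * m * ((n / m : ℕ) * U m) := by ring
    _ ≤ 2 * m * U n := mul_le_mul_of_nonneg_left (h2.trans h3) (by positivity)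

/-- Grouped by size, the binomial coefficient cancels and n U(m)/(m(m-1)) ≤ 2 U(n)/(m-1) remains. -/
theorem sum_sampleWeight_mul_le (h1 : 1 ≤ U 1) {n : ℕ} (hn : 2 ≤ n) :
    ∑ S ∈ (univ : Finset (Finset (Fin n))).filter (2 ≤ #·), sampleWeight n #S * U #S
      ≤ 6 * (U n * Real.log n) := by
  have hUn : (0 : ℝ) ≤ U n := le_trans (by positivity) (le_of_superadditive hU h1 (by omega : 1 ≤ n))
  have hn0 : (0 : ℝ) < n := by positivity
  have hterm : ∀ m ∈ Icc 2 n,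
      n.choose m * (sampleWeight n m * U m) ≤ 2 * U n * (1 / ((m : ℝ) - 1)) := by
    intro m hm
    rw [mem_Icc] at hm
    have hm2 : (2 : ℝ) ≤ m := by exact_mod_cast hm.1
    have hm1 : (0 : ℝ) < m - 1 := by linarith
    have hc : (0 : ℝ) < n.choose m := by exact_mod_cast Nat.choose_pos hm.2
    have h := le_ratio_of_superadditive hU h1 (by omega : 1 ≤ m) hm.2
    have e : n.choose m * (sampleWeight n m * U m) = n * U m / (m * (m - 1)) := by
      unfold sampleWeight
      field_simp
    rw [e, mul_one_div, div_le_div_iff₀ (by positivity) hm1]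
    nlinarith
  have hmaps : ∀ S ∈ (univ : Finset (Finset (Fin n))).filter (2 ≤ #·), #S ∈ Icc 2 n := by
    intro S hS
    rw [mem_filter] at hS
    exact mem_Icc.2 ⟨hS.2, by simpa using card_le_univ S⟩
  rw [← sum_fiberwise_of_maps_to hmaps]
  calc _ = ∑ m ∈ Icc 2 n, n.choose m * (sampleWeight n m * U m) := by
        refine sum_congr rfl fun m hm => ?_
        have hset : ((univ : Finset (Finset (Fin n))).filter (2 ≤ #·)).filter (#· = m)
            = powersetCard m univ := by
          ext S
          simp only [mem_filter, mem_univ, true_and, mem_powersetCard, subset_univ]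
          have := (mem_Icc.1 hm).1
          constructor
          · exact fun h => h.2
          · exact fun h => ⟨h ▸ this, h⟩
        rw [hset, sum_congr rfl fun S hS => by rw [(mem_powersetCard.1 hS).2], sum_const,
          card_powersetCard, card_univ, Fintype.card_fin, nsmul_eq_mul]
    _ ≤ ∑ m ∈ Icc 2 n, 2 * U n * (1 / ((m : ℝ) - 1)) := sum_le_sum hterm
    _ ≤ 2 * U n * (3 * Real.log n) := by
        rw [← mul_sum]
        exact mul_le_mul_of_nonneg_left (sum_one_div_sub_one_le n hn) (by positivity)
    _ = _ := by ring

/-- If at most `U m` of the configurations `x`, defined by the pair `B x` and killed by the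
elements of `M x`, are active in a sample of size `m`, then the expected number of exposed
configurations is `O(U n log n)`. -/
theorem sum_card_exposed_le {ι : Type*} (h1 : 1 ≤ U 1) {n : ℕ} (hn : 2 ≤ n) (X : Finset ι)
    (B M : ι → Finset (Fin n)) (hB : ∀ x ∈ X, #(B x) = 2) (hBM : ∀ x ∈ X, Disjoint (B x) (M x))
    (hact : ∀ S : Finset (Fin n), 2 ≤ #S → (#(X.filter fun x => S ∈ Icc (B x) (M x)ᶜ) : ℝ) ≤ U #S) :
    (∑ π : Equiv.Perm (Fin n), #(X.filter fun x => Exposed π (B x) (M x)) : ℕ)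
      ≤ n.factorial * (12 * (U n * Real.log n)) := by
  have hswap : (∑ π : Equiv.Perm (Fin n), #(X.filter fun x => Exposed π (B x) (M x)))
      = ∑ x ∈ X, #(univ.filter fun π : Equiv.Perm (Fin n) => Exposed π (B x) (M x)) :=
    sum_card_bipartiteAbove_eq_sum_card_bipartiteBelow _
  have hw : ∑ x ∈ X, (1 / ((#(M x) : ℝ) + 1)) ≤ 6 * (U n * Real.log n) := by
    calc ∑ x ∈ X, (1 / ((#(M x) : ℝ) + 1))
        = ∑ x ∈ X, ∑ S ∈ Icc (B x) (M x)ᶜ, sampleWeight n #S :=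
          sum_congr rfl fun x hx => (sum_sampleWeight (hB x hx) (hBM x hx)).symm
      _ = ∑ S ∈ (univ : Finset (Finset (Fin n))).filter (2 ≤ #·),
            ∑ x ∈ X.filter (fun x => S ∈ Icc (B x) (M x)ᶜ), sampleWeight n #S := by
          refine sum_comm' fun x S => ?_
          simp only [mem_filter, mem_univ, true_and]
          constructor
          · rintro ⟨hx, hS⟩
            exact ⟨⟨hx, hS⟩, (hB x hx) ▸ card_le_card (mem_Icc.1 hS).1⟩
          · rintro ⟨⟨hx, hS⟩, -⟩
            exact ⟨hx, hS⟩
      _ ≤ ∑ S ∈ (univ : Finset (Finset (Fin n))).filter (2 ≤ #·), sampleWeight n #S * U #S := by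
          refine sum_le_sum fun S hS => ?_
          rw [sum_const, nsmul_eq_mul, mul_comm]
          exact mul_le_mul_of_nonneg_left (hact S (mem_filter.1 hS).2) (sampleWeight_nonneg _ _)
      _ ≤ _ := sum_sampleWeight_mul_le hU h1 hn
  rw [hswap, Nat.cast_sum]
  calc ∑ x ∈ X, (#(univ.filter fun π : Equiv.Perm (Fin n) => Exposed π (B x) (M x)) : ℝ)
      ≤ ∑ x ∈ X, 2 * n.factorial * (1 / ((#(M x) : ℝ) + 1)) :=
        sum_le_sum fun x hx => card_exposed_le (hB x hx) (hBM x hx)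
    _ = 2 * n.factorial * ∑ x ∈ X, (1 / ((#(M x) : ℝ) + 1)) := by rw [mul_sum]
    _ ≤ 2 * n.factorial * (6 * (U n * Real.log n)) :=
        mul_le_mul_of_nonneg_left hw (by positivity)
    _ = _ := by ring

end Superadditive

end RandomStacking

namespace RandomStacking

open Set Topology

/-! ### Preconnected sets -/

theorem subset_or_disjoint_of_disjoint_frontier {α : Type*} [TopologicalSpace α] {P K : Set α}
    (hP : IsPreconnected P) (h : Disjoint P (frontier K)) : P ⊆ interior K ∨ Disjoint P K := by
  have hcov : P ⊆ interior K ∪ (closure K)ᶜ := by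
    intro x hx
    by_cases h1 : x ∈ interior K
    · exact Or.inl h1
    · refine Or.inr fun h2 => disjoint_left.1 h hx ⟨h2, h1⟩
  have hd : Disjoint (interior K) (closure K)ᶜ :=
    disjoint_left.2 fun x h1 h2 => h2 (subset_closure (interior_subset h1))
  rcases hP.subset_or_subset isOpen_interior isClosed_closure.isOpen_compl hd hcov with h1 | h1
  · exact Or.inl h1
  · exact Or.inr (disjoint_left.2 fun x hx hK => h1 hx (subset_closure hK))

/-- The trace of `t` on `s` is closed and relatively open in `s`. -/
theorem IsPreconnected.subset_of_mem_nhdsWithin {α : Type*} [TopologicalSpace α] {s t : Set α}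
    (hs : IsPreconnected s) (ht : IsClosed t) (hne : (s ∩ t).Nonempty)
    (h : ∀ x ∈ s ∩ t, t ∈ 𝓝[s] x) : s ⊆ t := by
  by_contra hst
  obtain ⟨y, hys, hyt⟩ := not_subset.1 hst
  obtain ⟨x, hxs, hxt⟩ := hne
  let u : Set α := ⋃₀ {u | IsOpen u ∧ u ∩ s ⊆ t}
  have hu : ∀ x ∈ s ∩ t, x ∈ u := by
    intro x hx
    obtain ⟨v, hv, hxv, hvt⟩ := mem_nhdsWithin.1 (h x hx)
    exact mem_sUnion.2 ⟨v, ⟨hv, hvt⟩, hxv⟩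
  obtain ⟨z, hzs, hzu, hzt⟩ := hs u tᶜ (isOpen_sUnion fun v hv => hv.1) ht.isOpen_compl
    (fun z hz => (em (z ∈ t)).imp (fun h => hu z ⟨hz, h⟩) id) ⟨x, hxs, hu x ⟨hxs, hxt⟩⟩ ⟨y, hys, hyt⟩
  obtain ⟨v, ⟨-, hvt⟩, hzv⟩ := mem_sUnion.1 hzu
  exact hzt (hvt ⟨hzv, hzs⟩)

/-- Near a point that is not interior to `K`, one of two sides of the boundary is free. -/
theorem disjoint_or_disjoint_of_nhds {α : Type*} [TopologicalSpace α] {K N P P' : Set α} {q : α}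
    (hK : IsClosed K) (hN : N ∈ 𝓝 q) (hq : q ∉ interior K) (hcov : N ⊆ frontier K ∪ P ∪ P')
    (hP : IsPreconnected P) (hP' : IsPreconnected P') (hd : Disjoint P (frontier K))
    (hd' : Disjoint P' (frontier K)) : Disjoint P K ∨ Disjoint P' K := by
  rcases subset_or_disjoint_of_disjoint_frontier hP hd with h | h
  · rcases subset_or_disjoint_of_disjoint_frontier hP' hd' with h' | h'
    -- If both sides were inside `K`, all of `N` would be, and `q` would be interior.
    · refine absurd (mem_interior_iff_mem_nhds.2 (Filter.mem_of_superset hN ?_)) hq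
      intro x hx
      rcases hcov hx with (hx | hx) | hx
      · exact hK.frontier_subset hx
      · exact interior_subset (h hx)
      · exact interior_subset (h' hx)
    · exact Or.inr h'
  · exact Or.inl h

/-! ### Topological disks -/

namespace Object

variable {k d : ℕ} (X : Object k d)

theorem isClosed_carrier : IsClosed X.carrier := by
  obtain ⟨h, hX⟩ := X.isDisk
  rw [← hX]
  exact h.isClosedMap _ Metric.isClosed_closedBall

theorem frontier_subset : frontier X.carrier ⊆ X.carrier := X.isClosed_carrier.frontier_subset

theorem mem_frontier_iff {p : Plane} :
    p ∈ frontier X.carrier ↔ p ∈ X.carrier ∧ p ∉ interior X.carrier := by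
  rw [X.isClosed_carrier.frontier_eq, mem_sdiff]

theorem exists_homeomorph : ∃ h : Plane ≃ₜ Plane, h '' Metric.closedBall 0 1 = X.carrier ∧
    h '' Metric.ball 0 1 = interior X.carrier ∧ h '' Metric.sphere 0 1 = frontier X.carrier := by
  obtain ⟨h, hX⟩ := X.isDisk
  refine ⟨h, hX, ?_, ?_⟩
  · rw [← hX, ← h.image_interior, interior_closedBall _ one_ne_zero]
  · rw [← hX, ← h.image_frontier, frontier_closedBall _ one_ne_zero]

theorem subset_closure_interior : X.carrier ⊆ closure (interior X.carrier) := by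
  obtain ⟨h, h1, h2, -⟩ := X.exists_homeomorph
  rw [← h1, ← h.image_interior, ← h.image_closure, interior_closedBall _ one_ne_zero,
    closure_ball _ one_ne_zero]

theorem isPreconnected_frontier : IsPreconnected (frontier X.carrier) := by
  obtain ⟨h, -, -, h3⟩ := X.exists_homeomorph
  rw [← h3]
  refine (isPreconnected_sphere ?_ _ _).image _ h.continuous.continuousOn
  rw [← Module.finrank_eq_rank, finrank_euclideanSpace_fin]
  norm_num

theorem frontier_nonempty : (frontier X.carrier).Nonempty := by
  obtain ⟨h, -, -, h3⟩ := X.exists_homeomorph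
  rw [← h3]
  exact (NormedSpace.sphere_nonempty.2 zero_le_one).image _

theorem dense_compl_frontier : Dense (frontier X.carrier)ᶜ :=
  interior_eq_empty_iff_dense_compl.1 (interior_frontier X.isClosed_carrier)

/-- The interior of a disk is locally connected at its boundary. -/
theorem exists_isPreconnected_inter_interior {q : Plane} (hq : q ∈ frontier X.carrier)
    {O : Set Plane} (hO : O ∈ 𝓝 q) :
    ∃ N, IsOpen N ∧ q ∈ N ∧ N ⊆ O ∧ IsPreconnected (N ∩ interior X.carrier) := by
  obtain ⟨h, -, h2, h3⟩ := X.exists_homeomorph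
  rw [← h3] at hq
  obtain ⟨x, -, rfl⟩ := hq
  obtain ⟨r, hr, hball⟩ := Metric.mem_nhds_iff.1 (h.continuous.continuousAt.preimage_mem_nhds hO)
  refine ⟨h '' Metric.ball x r, h.isOpenMap _ Metric.isOpen_ball,
    mem_image_of_mem _ (Metric.mem_ball_self hr), image_subset_iff.2 hball, ?_⟩
  rw [← h2, ← image_inter h.injective]
  exact ((convex_ball _ _).inter (convex_ball _ _)).isPreconnected.image _ h.continuous.continuousOn

/-- The exterior of a disk is locally connected at its boundary. -/
theorem exists_isPreconnected_diff {q : Plane} (hq : q ∈ frontier X.carrier)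
    {O : Set Plane} (hO : O ∈ 𝓝 q) :
    ∃ N, IsOpen N ∧ q ∈ N ∧ N ⊆ O ∧ IsPreconnected (N \ X.carrier) := by
  obtain ⟨h, h1, -, h3⟩ := X.exists_homeomorph
  rw [← h3] at hq
  obtain ⟨x, hx, rfl⟩ := hq
  rw [mem_sphere_zero_iff_norm] at hx
  -- Inversion in the unit circle fixes `x` and exchanges the two sides near it, so the exterior is
  -- locally the image of a convex set.
  let g : Plane → Plane := fun z => (‖z‖ ^ 2)⁻¹ • z
  have hnorm : ∀ z : Plane, z ≠ 0 → ‖g z‖ = ‖z‖⁻¹ := by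
    intro z hz
    have : ‖z‖ ≠ 0 := norm_ne_zero_iff.2 hz
    simp only [g, norm_smul, norm_inv, norm_pow, norm_norm]
    field_simp
  have hg0 : ∀ z : Plane, z ≠ 0 → g z ≠ 0 := by
    intro z hz
    rw [← norm_ne_zero_iff, hnorm z hz]
    exact inv_ne_zero (norm_ne_zero_iff.2 hz)
  have hgg : ∀ z : Plane, z ≠ 0 → g (g z) = z := by
    intro z hz
    have hz' : ‖z‖ ≠ 0 := norm_ne_zero_iff.2 hz
    change (‖g z‖ ^ 2)⁻¹ • ((‖z‖ ^ 2)⁻¹ • z) = z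
    rw [hnorm z hz, smul_smul]
    have : ((‖z‖⁻¹) ^ 2)⁻¹ * (‖z‖ ^ 2)⁻¹ = 1 := by field_simp
    rw [this, one_smul]
  have hcont : ContinuousOn g {0}ᶜ := by
    refine ContinuousOn.smul (ContinuousOn.inv₀ (continuous_norm.pow 2).continuousOn ?_) continuousOn_id
    intro z hz
    exact pow_ne_zero _ (norm_ne_zero_iff.2 hz)
  have hx0 : x ≠ 0 := by
    rw [← norm_ne_zero_iff, hx]
    exact one_ne_zero
  have hgx : g x = x := by simp [g, hx]
  have hcx : ContinuousAt (fun z => h (g z)) x :=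
    h.continuous.continuousAt.comp (hcont.continuousAt (isOpen_compl_singleton.mem_nhds hx0))
  have hO' : O ∈ 𝓝 (h (g x)) := by rwa [hgx]
  obtain ⟨r, hr, hball⟩ := Metric.mem_nhds_iff.1 (Filter.inter_mem (hcx.preimage_mem_nhds hO')
    (isOpen_compl_singleton.mem_nhds hx0))
  have hopen : IsOpen ({0}ᶜ ∩ g ⁻¹' Metric.ball x r) :=
    hcont.isOpen_inter_preimage isOpen_compl_singleton Metric.isOpen_ball
  refine ⟨h '' ({0}ᶜ ∩ g ⁻¹' Metric.ball x r), h.isOpenMap _ hopen,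
    mem_image_of_mem _ ⟨hx0, ?_⟩, ?_, ?_⟩
  · rw [mem_preimage, hgx]
    exact Metric.mem_ball_self hr
  · rintro _ ⟨z, ⟨hz, hzr⟩, rfl⟩
    have := (hball hzr).1
    rwa [mem_preimage, hgg z hz] at this
  · have himage : ({0}ᶜ ∩ g ⁻¹' Metric.ball x r) \ Metric.closedBall 0 1
        = g '' (Metric.ball x r ∩ Metric.ball 0 1) := by
      ext z
      constructor
      · rintro ⟨⟨hz, hzr⟩, hz1⟩
        refine ⟨g z, ⟨hzr, ?_⟩, hgg z hz⟩
        rw [mem_ball_zero_iff, hnorm z hz]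
        rw [mem_closedBall_zero_iff, not_le] at hz1
        exact inv_lt_one_of_one_lt₀ hz1
      · rintro ⟨y, ⟨hyr, hy1⟩, rfl⟩
        have hy0 : y ≠ 0 := (hball hyr).2
        refine ⟨⟨hg0 y hy0, ?_⟩, ?_⟩
        · rwa [mem_preimage, hgg y hy0]
        · rw [mem_closedBall_zero_iff, not_le, hnorm y hy0]
          exact (one_lt_inv₀ (norm_pos_iff.2 hy0)).2 (mem_ball_zero_iff.1 hy1)
    rw [← h1, ← image_sdiff h.injective, himage, image_image]
    refine ((convex_ball _ _).inter (convex_ball _ _)).isPreconnected.image _ ?_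
    exact h.continuous.comp_continuousOn (hcont.mono fun z hz => (hball hz.1).2)

end Object

/-! ### Proper crossings -/

/-- The axis-parallel rectangle `I × J`. -/
def rect (I J : Set ℝ) : Set Plane := {y | y 0 ∈ I ∧ y 1 ∈ J}

theorem convex_rect {I J : Set ℝ} (hI : Convex ℝ I) (hJ : Convex ℝ J) : Convex ℝ (rect I J) :=
  fun _ hx _ hy _ _ ha hb hab => ⟨hI hx.1 hy.1 ha hb hab, hJ hx.2 hy.2 ha hb hab⟩

theorem isOpen_rect {I J : Set ℝ} (hI : IsOpen I) (hJ : IsOpen J) : IsOpen (rect I J) :=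
  (hI.preimage (by fun_prop : Continuous fun y : Plane => y 0)).inter
    (hJ.preimage (by fun_prop : Continuous fun y : Plane => y 1))

theorem exists_rect_subset {O : Set Plane} (hO : O ∈ 𝓝 0) :
    ∃ r > 0, rect (Ioo (-r) r) (Ioo (-r) r) ⊆ O := by
  obtain ⟨r, hr, h⟩ := Metric.mem_nhds_iff.1 hO
  -- The half-diagonal of this square is r/√2 < r.
  refine ⟨r / 2, by positivity, fun y hy => h ?_⟩
  rw [mem_ball_zero_iff, EuclideanSpace.norm_eq, Fin.sum_univ_two,
    Real.sqrt_lt' hr]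
  have h0 := abs_lt.2 hy.1
  have h1 := abs_lt.2 hy.2
  rw [Real.norm_eq_abs, Real.norm_eq_abs]
  have := abs_nonneg (y 0)
  have := abs_nonneg (y 1)
  nlinarith

/-- Local coordinates at a proper crossing: the images of rectangles. -/
theorem CrossProperlyAt.exists_chart {A B : Set Plane} {q : Plane} (hc : CrossProperlyAt A B q)
    {O : Set Plane} (hO : O ∈ 𝓝 q) :
    ∃ r > 0, ∃ g : Plane → Plane,
      (∀ I ⊆ Ioo (-r) r, ∀ J ⊆ Ioo (-r) r, Convex ℝ I → Convex ℝ J →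
        IsPreconnected (g '' rect I J)) ∧
      g '' rect (Ioo (-r) r) (Ioo (-r) r) ∈ 𝓝 q ∧
      g '' rect (Ioo (-r) r) (Ioo (-r) r) ⊆ O ∧
      ∀ y ∈ rect (Ioo (-r) r) (Ioo (-r) r), (g y ∈ A ↔ y 0 = 0) ∧ (g y ∈ B ↔ y 1 = 0) := by
  obtain ⟨φ, hq, hq0, hφ⟩ := hc
  have h0 : (0 : Plane) ∈ φ.target := hq0 ▸ φ.map_source hq
  have hs0 : φ.symm 0 = q := by rw [← hq0, φ.left_inv hq]
  have hO' : φ.symm ⁻¹' O ∈ 𝓝 (0 : Plane) := by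
    refine (φ.continuousAt_symm h0).preimage_mem_nhds ?_
    rwa [hs0]
  obtain ⟨r, hr, hsub⟩ := exists_rect_subset (Filter.inter_mem hO' (φ.open_target.mem_nhds h0))
  refine ⟨r, hr, φ.symm, ?_, ?_, ?_, ?_⟩
  · intro I hI J hJ hIc hJc
    refine (convex_rect hIc hJc).isPreconnected.image _ (φ.continuousOn_symm.mono ?_)
    exact fun y hy => (hsub ⟨hI hy.1, hJ hy.2⟩).2
  · refine IsOpen.mem_nhds ?_ ⟨0, ?_, hs0⟩
    · exact φ.isOpen_image_symm_of_subset_target (isOpen_rect isOpen_Ioo isOpen_Ioo)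
        fun y hy => (hsub hy).2
    · simp [rect, hr]
  · rintro _ ⟨y, hy, rfl⟩
    exact (hsub hy).1
  · intro y hy
    have ht := (hsub hy).2
    have := hφ (φ.symm y) (φ.map_target ht)
    rwa [φ.right_inv ht] at this

theorem Ioo_subset_split {r t : ℝ} (h : t ∈ Ioo (-r) r) : t = 0 ∨ t ∈ Ioo 0 r ∨ t ∈ Ioo (-r) 0 := by
  rcases lt_trichotomy t 0 with h1 | h1 | h1
  · exact Or.inr (Or.inr ⟨h.1, h1⟩)
  · exact Or.inl h1
  · exact Or.inr (Or.inl ⟨h1, h.2⟩)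

/-- Near a proper crossing of their boundaries there are points outside of both objects. -/
theorem CrossProperlyAt.exists_notMem {k d : ℕ} {X Y : Object k d} {q : Plane}
    (hX : q ∈ frontier X.carrier) (hY : q ∈ frontier Y.carrier)
    (hc : CrossProperlyAt (frontier X.carrier) (frontier Y.carrier) q) {O : Set Plane}
    (hO : O ∈ 𝓝 q) : ∃ z ∈ O, z ∉ X.carrier ∧ z ∉ Y.carrier := by
  obtain ⟨r, hr, g, hpre, hnhds, hsub, hax⟩ := hc.exists_chart hO
  have hp : Ioo 0 r ⊆ Ioo (-r) r := Ioo_subset_Ioo_left (by linarith)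
  have hm : Ioo (-r) 0 ⊆ Ioo (-r) r := Ioo_subset_Ioo_right hr.le
  -- One side of each boundary is free of its object, so a whole coordinate line misses `X` and a
  -- transverse one misses `Y`; their intersection is the required point.
  have hx : ∃ s ∈ Ioo (-r) r, ∀ y ∈ rect (Ioo (-r) r) (Ioo (-r) r), y 0 = s → g y ∉ X.carrier := by
    have h := disjoint_or_disjoint_of_nhds (P := g '' rect (Ioo 0 r) (Ioo (-r) r))
      (P' := g '' rect (Ioo (-r) 0) (Ioo (-r) r)) X.isClosed_carrier hnhds (X.mem_frontier_iff.1 hX).2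
      ?_ (hpre _ hp _ subset_rfl (convex_Ioo _ _) (convex_Ioo _ _))
      (hpre _ hm _ subset_rfl (convex_Ioo _ _) (convex_Ioo _ _)) ?_ ?_
    · rcases h with h | h
      · exact ⟨r / 2, ⟨by linarith, by linarith⟩, fun y hy hs =>
          disjoint_left.1 h ⟨y, ⟨hs ▸ ⟨by linarith, by linarith⟩, hy.2⟩, rfl⟩⟩
      · exact ⟨-(r / 2), ⟨by linarith, by linarith⟩, fun y hy hs =>
          disjoint_left.1 h ⟨y, ⟨hs ▸ ⟨by linarith, by linarith⟩, hy.2⟩, rfl⟩⟩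
    · rintro _ ⟨y, hy, rfl⟩
      rcases Ioo_subset_split hy.1 with h | h | h
      · exact Or.inl (Or.inl ((hax y hy).1.2 h))
      · exact Or.inl (Or.inr ⟨y, ⟨h, hy.2⟩, rfl⟩)
      · exact Or.inr ⟨y, ⟨h, hy.2⟩, rfl⟩
    · refine disjoint_left.2 ?_
      rintro _ ⟨y, hy, rfl⟩ hf
      exact hy.1.1.ne' ((hax y ⟨hp hy.1, hy.2⟩).1.1 hf)
    · refine disjoint_left.2 ?_
      rintro _ ⟨y, hy, rfl⟩ hf
      exact hy.1.2.ne ((hax y ⟨hm hy.1, hy.2⟩).1.1 hf)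
  have hy : ∃ s ∈ Ioo (-r) r, ∀ y ∈ rect (Ioo (-r) r) (Ioo (-r) r), y 1 = s → g y ∉ Y.carrier := by
    have h := disjoint_or_disjoint_of_nhds (P := g '' rect (Ioo (-r) r) (Ioo 0 r))
      (P' := g '' rect (Ioo (-r) r) (Ioo (-r) 0)) Y.isClosed_carrier hnhds (Y.mem_frontier_iff.1 hY).2
      ?_ (hpre _ subset_rfl _ hp (convex_Ioo _ _) (convex_Ioo _ _))
      (hpre _ subset_rfl _ hm (convex_Ioo _ _) (convex_Ioo _ _)) ?_ ?_
    · rcases h with h | h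
      · exact ⟨r / 2, ⟨by linarith, by linarith⟩, fun y hy hs =>
          disjoint_left.1 h ⟨y, ⟨hy.1, hs ▸ ⟨by linarith, by linarith⟩⟩, rfl⟩⟩
      · exact ⟨-(r / 2), ⟨by linarith, by linarith⟩, fun y hy hs =>
          disjoint_left.1 h ⟨y, ⟨hy.1, hs ▸ ⟨by linarith, by linarith⟩⟩, rfl⟩⟩
    · rintro _ ⟨y, hy, rfl⟩
      rcases Ioo_subset_split hy.2 with h | h | h
      · exact Or.inl (Or.inl ((hax y hy).2.2 h))
      · exact Or.inl (Or.inr ⟨y, ⟨hy.1, h⟩, rfl⟩)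
      · exact Or.inr ⟨y, ⟨hy.1, h⟩, rfl⟩
    · refine disjoint_left.2 ?_
      rintro _ ⟨y, hy, rfl⟩ hf
      exact hy.2.1.ne' ((hax y ⟨hy.1, hp hy.2⟩).2.1 hf)
    · refine disjoint_left.2 ?_
      rintro _ ⟨y, hy, rfl⟩ hf
      exact hy.2.2.ne ((hax y ⟨hy.1, hm hy.2⟩).2.1 hf)
  obtain ⟨s, hs, hsX⟩ := hx
  obtain ⟨t, ht, htY⟩ := hy
  have hmem : (!₂[s, t] : Plane) ∈ rect (Ioo (-r) r) (Ioo (-r) r) := ⟨by simpa using hs, by simpa using ht⟩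
  exact ⟨g !₂[s, t], hsub ⟨_, hmem, rfl⟩, hsX _ hmem (by simp), htY _ hmem (by simp)⟩

/-- Near a proper crossing, the complement of the two curves falls into four pieces. -/
theorem CrossProperlyAt.exists_pieces {A B : Set Plane} {q : Plane} (hc : CrossProperlyAt A B q)
    {O : Set Plane} (hO : O ∈ 𝓝 q) :
    ∃ P : Fin 4 → Set Plane, (∀ a, IsPreconnected (P a) ∧ P a ⊆ O ∧ Disjoint (P a) (A ∪ B)) ∧
      A ∪ B ∪ ⋃ a, P a ∈ 𝓝 q := by
  obtain ⟨r, hr, g, hpre, hnhds, hsub, hax⟩ := hc.exists_chart hO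
  have hp : Ioo 0 r ⊆ Ioo (-r) r := Ioo_subset_Ioo_left (by linarith)
  have hm : Ioo (-r) 0 ⊆ Ioo (-r) r := Ioo_subset_Ioo_right hr.le
  have key : ∀ I ⊆ Ioo (-r) r, ∀ J ⊆ Ioo (-r) r, Convex ℝ I → Convex ℝ J → (0 : ℝ) ∉ I → (0 : ℝ) ∉ J →
      IsPreconnected (g '' rect I J) ∧ g '' rect I J ⊆ O ∧ Disjoint (g '' rect I J) (A ∪ B) := by
    intro I hI J hJ hIc hJc hI0 hJ0
    refine ⟨hpre I hI J hJ hIc hJc, ?_, disjoint_left.2 ?_⟩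
    · rintro _ ⟨y, hy, rfl⟩
      exact hsub ⟨y, ⟨hI hy.1, hJ hy.2⟩, rfl⟩
    · rintro _ ⟨y, hy, rfl⟩ (hf | hf)
      · exact hI0 ((hax y ⟨hI hy.1, hJ hy.2⟩).1.1 hf ▸ hy.1)
      · exact hJ0 ((hax y ⟨hI hy.1, hJ hy.2⟩).2.1 hf ▸ hy.2)
  have hp0 : (0 : ℝ) ∉ Ioo 0 r := left_notMem_Ioo
  have hm0 : (0 : ℝ) ∉ Ioo (-r) 0 := right_notMem_Ioo
  have cp : Convex ℝ (Ioo 0 r) := convex_Ioo _ _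
  have cm : Convex ℝ (Ioo (-r) 0) := convex_Ioo _ _
  refine ⟨![g '' rect (Ioo 0 r) (Ioo 0 r), g '' rect (Ioo 0 r) (Ioo (-r) 0),
    g '' rect (Ioo (-r) 0) (Ioo 0 r), g '' rect (Ioo (-r) 0) (Ioo (-r) 0)], ?_, ?_⟩
  · intro a
    fin_cases a
    · exact key _ hp _ hp cp cp hp0 hp0
    · exact key _ hp _ hm cp cm hp0 hm0
    · exact key _ hm _ hp cm cp hm0 hp0
    · exact key _ hm _ hm cm cm hm0 hm0
  · refine Filter.mem_of_superset hnhds ?_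
    rintro _ ⟨y, hy, rfl⟩
    rcases Ioo_subset_split hy.1 with h | h
    · exact Or.inl (Or.inl ((hax y hy).1.2 h))
    rcases Ioo_subset_split hy.2 with h' | h'
    · exact Or.inl (Or.inr ((hax y hy).2.2 h'))
    refine Or.inr (mem_iUnion.2 ?_)
    rcases h with h | h <;> rcases h' with h' | h'
    · exact ⟨0, y, ⟨h, h'⟩, rfl⟩
    · exact ⟨1, y, ⟨h, h'⟩, rfl⟩
    · exact ⟨2, y, ⟨h, h'⟩, rfl⟩
    · exact ⟨3, y, ⟨h, h'⟩, rfl⟩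

end RandomStacking

namespace RandomStacking

open Set Topology

/-! ### Local structure of a stacking -/

section Stacking

variable {k d n : ℕ} (D : Fin n → Object k d)

open Classical in
/-- The objects with the point `q` on their boundary. -/
noncomputable def boundaryAt (q : Plane) : Finset (Fin n) :=
  Finset.univ.filter fun i => q ∈ frontier (D i).carrier

open Classical in
/-- The objects with the point `q` in their interior. -/
noncomputable def interiorAt (q : Plane) : Finset (Fin n) :=
  Finset.univ.filter fun i => q ∈ interior (D i).carrier

/-- The crossings: the common boundary points of two objects. -/
def crossings : Set Plane :=
  {q | ∃ i j, i ≠ j ∧ q ∈ frontier (D i).carrier ∩ frontier (D j).carrier}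

variable {D} {π : Equiv.Perm (Fin n)} {i : Fin n} {q : Plane}

theorem mem_boundaryAt {a : Fin n} : a ∈ boundaryAt D q ↔ q ∈ frontier (D a).carrier := by
  simp [boundaryAt]

theorem mem_interiorAt {a : Fin n} : a ∈ interiorAt D q ↔ q ∈ interior (D a).carrier := by
  simp [interiorAt]

theorem disjoint_boundaryAt_interiorAt : Disjoint (boundaryAt D q) (interiorAt D q) :=
  Finset.disjoint_left.2 fun a h1 h2 =>
    ((D a).mem_frontier_iff.1 (mem_boundaryAt.1 h1)).2 (mem_interiorAt.1 h2)

theorem GeneralPosition.finite_crossings (hD : GeneralPosition D) : (crossings D).Finite := by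
  have : crossings D ⊆ ⋃ i, ⋃ j, ⋃ (_ : i ≠ j), frontier (D i).carrier ∩ frontier (D j).carrier := by
    rintro q ⟨i, j, hij, hq⟩
    simp only [mem_iUnion]
    exact ⟨i, j, hij, hq⟩
  exact (finite_iUnion fun i => finite_iUnion fun j => finite_iUnion fun h =>
    hD.finite_inter i j h).subset this

theorem GeneralPosition.eq_or_eq (hD : GeneralPosition D) {a b c : Fin n} (hab : a ≠ b)
    (ha : q ∈ frontier (D a).carrier) (hb : q ∈ frontier (D b).carrier)
    (hc : q ∈ frontier (D c).carrier) : c = a ∨ c = b := by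
  by_contra! h
  have := hD.no_three a b c hab h.1.symm h.2.symm
  exact (this ▸ ⟨⟨ha, hb⟩, hc⟩ : q ∈ (∅ : Set Plane))

theorem GeneralPosition.card_boundaryAt (hD : GeneralPosition D) (hq : q ∈ crossings D) :
    (boundaryAt D q).card = 2 := by
  obtain ⟨a, b, hab, ha, hb⟩ := hq
  rw [Finset.card_eq_two]
  refine ⟨a, b, hab, ?_⟩
  ext c
  rw [mem_boundaryAt, Finset.mem_insert, Finset.mem_singleton]
  constructor
  · exact hD.eq_or_eq hab ha hb
  · rintro (rfl | rfl)
    · exact ha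
    · exact hb

theorem isOpen_visiblePart : IsOpen (visiblePart D π i) :=
  isOpen_interior.sdiff (isClosed_iUnion_of_finite fun j => isClosed_iUnion_of_finite fun _ =>
    (D (π j)).isClosed_carrier)

theorem mem_visiblePart : q ∈ visiblePart D π i ↔
    q ∈ interior (D (π i)).carrier ∧ ∀ j, i < j → q ∉ (D (π j)).carrier := by
  simp [visiblePart]

theorem visiblePart_index_unique {i' : Fin n} (h : q ∈ visiblePart D π i)
    (h' : q ∈ visiblePart D π i') : i = i' := by
  rw [mem_visiblePart] at h h'
  rcases lt_trichotomy i i' with hlt | heq | hlt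
  · exact absurd (interior_subset h'.1) (h.2 _ hlt)
  · exact heq
  · exact absurd (interior_subset h.1) (h'.2 _ hlt)

/-- The closed face with the interior point `x` on level `i`. -/
def faceAt (D : Fin n → Object k d) (π : Equiv.Perm (Fin n)) (i : Fin n) (x : Plane) : Set Plane :=
  closure (connectedComponentIn (visiblePart D π i) x)

variable {x : Plane}

theorem faceAt_subset_carrier : faceAt D π i x ⊆ (D (π i)).carrier :=
  closure_minimal (fun _ hy => interior_subset
    (mem_visiblePart.1 (connectedComponentIn_subset _ _ hy)).1) (D (π i)).isClosed_carrier

theorem disjoint_faceAt_interior {j : Fin n} (hj : i < j) :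
    Disjoint (faceAt D π i x) (interior (D (π j)).carrier) :=
  (disjoint_left.2 fun _ hy hy' =>
    (mem_visiblePart.1 (connectedComponentIn_subset _ _ hy)).2 j hj (interior_subset hy')
    : Disjoint (connectedComponentIn (visiblePart D π i) x) _).closure_left isOpen_interior

/-- A face is a neighborhood of each of its points that is visible on its level. -/
theorem faceAt_mem_nhds (hq : q ∈ faceAt D π i x) (hv : q ∈ visiblePart D π i) :
    faceAt D π i x ∈ 𝓝 q := by
  set C := connectedComponentIn (visiblePart D π i) x with hC
  have hx : x ∈ visiblePart D π i := by
    rw [← connectedComponentIn_nonempty_iff]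
    exact closure_nonempty_iff.1 ⟨q, hq⟩
  -- A set between a connected set and its closure is connected, so a visible `q` already belongs to
  -- the component.
  have hpre : IsPreconnected (insert q C) :=
    isPreconnected_connectedComponentIn.subset_closure (subset_insert _ _)
      (insert_subset hq subset_closure)
  have hsub := hpre.subset_connectedComponentIn (mem_insert_of_mem _ (mem_connectedComponentIn hx))
    (insert_subset hv (connectedComponentIn_subset _ _))
  exact Filter.mem_of_superset (isOpen_visiblePart.connectedComponentIn.mem_nhds
    (hsub (mem_insert _ _))) subset_closure

/-- An object drawn later would hide a whole neighborhood of `q`. -/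
theorem interiorAt_le (hq : q ∈ faceAt D π i x) {l : Fin n} (hl : l ∈ interiorAt D q) :
    π.symm l ≤ i := by
  by_contra! h
  have := disjoint_left.1 (disjoint_faceAt_interior h) hq
  rw [Equiv.apply_symm_apply] at this
  exact this (mem_interiorAt.1 hl)

/-- A point of a face that is not visible lies on the boundary of an object of at least the same
level. -/
theorem exists_mem_boundaryAt (hq : q ∈ faceAt D π i x) (hv : q ∉ visiblePart D π i) :
    ∃ a ∈ boundaryAt D q, i ≤ π.symm a := by
  by_cases h1 : q ∈ interior (D (π i)).carrier
  · rw [mem_visiblePart] at hv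
    push Not at hv
    obtain ⟨j, hj, hqj⟩ := hv h1
    refine ⟨π j, mem_boundaryAt.2 ((D (π j)).mem_frontier_iff.2 ⟨hqj, ?_⟩), ?_⟩
    · exact disjoint_left.1 (disjoint_faceAt_interior hj) hq
    · rw [Equiv.symm_apply_apply]
      exact hj.le
  · refine ⟨π i, mem_boundaryAt.2 ((D (π i)).mem_frontier_iff.2 ⟨faceAt_subset_carrier hq, h1⟩), ?_⟩
    rw [Equiv.symm_apply_apply]

/-- Every object with `q` in its interior has level at most `i`, hence at most that of `a`, and it
cannot be `a` itself. -/
theorem exposed_of_le (hq : q ∈ faceAt D π i x) {a : Fin n} (ha : a ∈ boundaryAt D q)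
    (hia : i ≤ π.symm a) : Exposed π (boundaryAt D q) (interiorAt D q) := by
  refine ⟨a, ha, fun l hl => lt_of_le_of_ne ((interiorAt_le hq hl).trans hia) fun h => ?_⟩
  rw [π.symm.injective h] at hl
  exact Finset.disjoint_left.1 disjoint_boundaryAt_interiorAt ha hl

/-- A preconnected set that meets no boundary and contains a point of a component of a visible
part lies in this component. -/
theorem subset_component {P : Set Plane} (hP : IsPreconnected P)
    (hd : ∀ a, Disjoint P (frontier (D a).carrier)) {z : Plane} (hz : z ∈ P)
    (hzC : z ∈ connectedComponentIn (visiblePart D π i) x) :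
    P ⊆ connectedComponentIn (visiblePart D π i) x := by
  rw [connectedComponentIn_eq hzC]
  refine hP.subset_connectedComponentIn hz fun y hy => ?_
  have hzv := mem_visiblePart.1 (connectedComponentIn_subset _ _ hzC)
  refine mem_visiblePart.2 ⟨?_, fun j hj => ?_⟩
  · rcases subset_or_disjoint_of_disjoint_frontier hP (hd (π i)) with h | h
    · exact h hy
    · exact absurd (interior_subset hzv.1) (disjoint_left.1 h hz)
  · rcases subset_or_disjoint_of_disjoint_frontier hP (hd (π j)) with h | h
    · exact absurd (interior_subset (h hz)) (hzv.2 j hj)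
    · exact disjoint_left.1 h hy

theorem dense_compl_frontiers : Dense (⋃ a, frontier (D a).carrier)ᶜ := by
  rw [compl_iUnion]
  exact dense_iInter_of_isOpen (fun a => isClosed_frontier.isOpen_compl)
    fun a => (D a).dense_compl_frontier

/-- The points near `q` that lie only on boundaries through `q`. -/
theorem compl_frontiers_mem_nhds (D : Fin n → Object k d) (q : Plane) :
    (⋃ a, ⋃ (_ : a ∉ boundaryAt D q), frontier (D a).carrier)ᶜ ∈ 𝓝 q := by
  refine IsClosed.compl_mem_nhds ?_ ?_
  · exact isClosed_iUnion_of_finite fun a => isClosed_iUnion_of_finite fun _ => isClosed_frontier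
  · simp [mem_boundaryAt]

/-- The component is open and the boundaries are nowhere dense, so a point off all boundaries can be
chosen; such a point must fall into a piece of a piece cover. -/
theorem exists_component_meets {N : Set Plane} (hq : q ∈ faceAt D π i x) (hN : N ∈ 𝓝 q) :
    ∃ z ∈ N, (∀ a, z ∉ frontier (D a).carrier) ∧
      z ∈ connectedComponentIn (visiblePart D π i) x := by
  obtain ⟨N', hN'N, hN', hqN'⟩ := mem_nhds_iff.1 hN
  obtain ⟨y, hyN, hyC⟩ := mem_closure_iff.1 hq N' hN' hqN'
  obtain ⟨z, ⟨hzN, hzC⟩, hz⟩ := dense_compl_frontiers (D := D).inter_open_nonempty _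
    (hN'.inter isOpen_visiblePart.connectedComponentIn) ⟨y, hyN, hyC⟩
  simp only [mem_compl_iff, mem_iUnion, not_exists] at hz
  exact ⟨z, hN'N hzN, hz, hzC⟩

/-- Pieces around `q` that every face through `q` has to contain one of. -/
structure IsPieceCover {m : ℕ} (D : Fin n → Object k d) (q : Plane) (P : Fin m → Set Plane) :
    Prop where
  isPreconnected : ∀ c, IsPreconnected (P c)
  disjoint : ∀ c a, Disjoint (P c) (frontier (D a).carrier)
  mem_nhds : (⋃ a, frontier (D a).carrier) ∪ (⋃ c, P c) ∈ 𝓝 q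

theorem IsPieceCover.exists_subset {m : ℕ} {P : Fin m → Set Plane} (hP : IsPieceCover D q P)
    (hq : q ∈ faceAt D π i x) :
    ∃ c, (P c).Nonempty ∧ P c ⊆ connectedComponentIn (visiblePart D π i) x := by
  obtain ⟨z, hzN, hz, hzC⟩ := exists_component_meets hq hP.mem_nhds
  rcases hzN with h | h
  · obtain ⟨a, ha⟩ := mem_iUnion.1 h
    exact absurd ha (hz a)
  · obtain ⟨c, hc⟩ := mem_iUnion.1 h
    exact ⟨c, ⟨z, hc⟩, subset_component (hP.isPreconnected c) (hP.disjoint c) hc hzC⟩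

/-- Visible parts of different levels are disjoint, so a nonempty piece determines the level and the
component containing it: faces through `q` inject into pieces. -/
theorem IsPieceCover.encard_faces_le {m : ℕ} [NeZero m] {P : Fin m → Set Plane} (hP : IsPieceCover D q P) :
    {f | f ∈ faces D π ∧ q ∈ f}.encard ≤ m := by
  have h : ∀ f ∈ {f | f ∈ faces D π ∧ q ∈ f}, ∃ c, (P c).Nonempty ∧
      ∃ i x, f = faceAt D π i x ∧ P c ⊆ connectedComponentIn (visiblePart D π i) x := by
    rintro f ⟨⟨i, x, hx, rfl⟩, hq⟩
    obtain ⟨c, hne, hc⟩ := hP.exists_subset hq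
    exact ⟨c, hne, i, x, rfl, hc⟩
  choose! c hc using h
  have hinj : InjOn c {f | f ∈ faces D π ∧ q ∈ f} := by
    intro f hf f' hf' hcc
    obtain ⟨⟨z, hz⟩, i, x, hfx, hP1⟩ := hc f hf
    obtain ⟨-, i', x', hfx', hP2⟩ := hc f' hf'
    rw [← hcc] at hP2
    obtain rfl := visiblePart_index_unique (connectedComponentIn_subset _ _ (hP1 hz))
      (connectedComponentIn_subset _ _ (hP2 hz))
    rw [hfx, hfx', faceAt, faceAt, connectedComponentIn_eq (hP1 hz),
      ← connectedComponentIn_eq (hP2 hz)]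
  rw [← hinj.encard_image]
  refine (encard_le_encard (subset_univ _)).trans ?_
  simp [encard_univ]

theorem boundaryAt_eq_singleton (hq : q ∉ crossings D) {a : Fin n} (ha : a ∈ boundaryAt D q) :
    boundaryAt D q = {a} := by
  refine Finset.eq_singleton_iff_unique_mem.2 ⟨ha, fun b hb => ?_⟩
  by_contra hba
  exact hq ⟨b, a, hba, mem_boundaryAt.1 hb, mem_boundaryAt.1 ha⟩

/-- The two sides of the boundary of an object at a point that is not a crossing. -/
theorem exists_isPieceCover_of_notMem (hq : q ∉ crossings D) {a : Fin n}
    (ha : a ∈ boundaryAt D q) :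
    ∃ N₁ N₂ : Set Plane, N₁ ∈ 𝓝 q ∧ IsOpen N₁ ∧ N₂ ∈ 𝓝 q ∧ IsOpen N₂ ∧
      IsPieceCover D q ![N₁ ∩ interior (D a).carrier, N₂ \ (D a).carrier] := by
  have hO := compl_frontiers_mem_nhds D q
  rw [boundaryAt_eq_singleton hq ha] at hO
  obtain ⟨N₁, ho₁, hq₁, hs₁, hp₁⟩ :=
    (D a).exists_isPreconnected_inter_interior (mem_boundaryAt.1 ha) hO
  obtain ⟨N₂, ho₂, hq₂, hs₂, hp₂⟩ :=
    (D a).exists_isPreconnected_diff (mem_boundaryAt.1 ha) hO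
  have hother : ∀ y ∈ (⋃ b, ⋃ (_ : b ∉ ({a} : Finset (Fin n))), frontier (D b).carrier)ᶜ,
      ∀ b ≠ a, y ∉ frontier (D b).carrier := by
    intro y hy b hb hyb
    refine hy ?_
    simp only [mem_iUnion]
    exact ⟨b, by simpa using hb, hyb⟩
  refine ⟨N₁, N₂, ho₁.mem_nhds hq₁, ho₁, ho₂.mem_nhds hq₂, ho₂, ?_, ?_, ?_⟩
  · intro c
    fin_cases c
    · exact hp₁
    · exact hp₂
  · intro c b
    fin_cases c
    · refine disjoint_left.2 fun y hy hyb => ?_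
      by_cases h : b = a
      · subst h
        exact ((D b).mem_frontier_iff.1 hyb).2 hy.2
      · exact hother y (hs₁ hy.1) b h hyb
    · refine disjoint_left.2 fun y hy hyb => ?_
      by_cases h : b = a
      · subst h
        exact hy.2 ((D b).frontier_subset hyb)
      · exact hother y (hs₂ hy.1) b h hyb
  · refine Filter.mem_of_superset (Filter.inter_mem (ho₁.mem_nhds hq₁) (ho₂.mem_nhds hq₂)) ?_
    rintro y ⟨hy₁, hy₂⟩
    by_cases h : y ∈ (D a).carrier
    · by_cases h' : y ∈ interior (D a).carrier
      · exact Or.inr (mem_iUnion.2 ⟨0, hy₁, h'⟩)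
      · exact Or.inl (mem_iUnion.2 ⟨a, (D a).mem_frontier_iff.2 ⟨h, h'⟩⟩)
    · exact Or.inr (mem_iUnion.2 ⟨1, hy₂, h⟩)

theorem GeneralPosition.exists_isPieceCover (hD : GeneralPosition D) (hq : q ∈ crossings D) :
    ∃ P : Fin 4 → Set Plane, IsPieceCover D q P := by
  have hO := compl_frontiers_mem_nhds D q
  obtain ⟨a, b, hab, ha, hb⟩ := hq
  obtain ⟨P, hP, hN⟩ := (hD.cross a b hab q ⟨ha, hb⟩).exists_pieces hO
  refine ⟨P, fun c => (hP c).1, fun c e => ?_, Filter.mem_of_superset hN ?_⟩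
  · obtain ⟨-, hs, hd⟩ := hP c
    by_cases he : e ∈ boundaryAt D q
    · rcases hD.eq_or_eq hab ha hb (mem_boundaryAt.1 he) with rfl | rfl
      · exact hd.mono_right subset_union_left
      · exact hd.mono_right subset_union_right
    · refine disjoint_left.2 fun y hy hye => hs hy ?_
      simp only [mem_iUnion]
      exact ⟨e, he, hye⟩
  · exact union_subset_union_left _ (union_subset (subset_iUnion (fun a => frontier (D a).carrier) a)
      (subset_iUnion (fun a => frontier (D a).carrier) b))

/-- A point on some boundary lies in at most four faces. -/
theorem GeneralPosition.encard_faces_le (hD : GeneralPosition D) {a : Fin n}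
    (ha : q ∈ frontier (D a).carrier) : {f | f ∈ faces D π ∧ q ∈ f}.encard ≤ 4 := by
  by_cases hq : q ∈ crossings D
  · obtain ⟨P, hP⟩ := hD.exists_isPieceCover hq
    exact hP.encard_faces_le
  · obtain ⟨N₁, N₂, -, -, -, -, hP⟩ := exists_isPieceCover_of_notMem hq (mem_boundaryAt.2 ha)
    exact hP.encard_faces_le.trans (by norm_num)

/-- A boundary that leaves a face does so at an exposed crossing. -/
theorem exposed_of_notMem_nhdsWithin {a : Fin n} (hq : q ∈ faceAt D π i x)
    (ha : q ∈ frontier (D a).carrier) (hn : faceAt D π i x ∉ 𝓝[frontier (D a).carrier] q) :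
    q ∈ crossings D ∧ Exposed π (boundaryAt D q) (interiorAt D q) := by
  have hv : q ∉ visiblePart D π i := fun h => hn (mem_nhdsWithin_of_mem_nhds (faceAt_mem_nhds hq h))
  obtain ⟨b, hb, hib⟩ := exists_mem_boundaryAt hq hv
  refine ⟨?_, exposed_of_le hq hb hib⟩
  -- Away from crossings there are only two local sides. The face contains one of them, and the
  -- closure of either side contains the boundary near `q`, against `hn`.
  by_contra hc
  obtain ⟨N₁, N₂, hN₁, ho₁, hN₂, ho₂, hP⟩ := exists_isPieceCover_of_notMem hc (mem_boundaryAt.2 ha)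
  obtain ⟨c, -, hsub⟩ := hP.exists_subset hq
  have hcl := closure_mono hsub
  refine hn ?_
  fin_cases c
  · refine mem_nhdsWithin.2 ⟨N₁, ho₁, mem_of_mem_nhds hN₁, fun y hy => hcl ?_⟩
    exact ho₁.inter_closure ⟨hy.1, (D a).subset_closure_interior ((D a).frontier_subset hy.2)⟩
  · refine mem_nhdsWithin.2 ⟨N₂, ho₂, mem_of_mem_nhds hN₂, fun y hy => hcl ?_⟩
    refine ho₂.inter_closure ⟨hy.1, ?_⟩
    have := hy.2
    rw [frontier_eq_closure_inter_closure] at this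
    exact this.2

/-- An object in conflict with a face has its boundary inside of the face or meets it in an exposed
crossing. -/
theorem subset_or_exists_exposed {a : Fin n} (hne : (frontier (D a).carrier ∩ faceAt D π i x).Nonempty) :
    frontier (D a).carrier ⊆ faceAt D π i x ∨
      ∃ q ∈ frontier (D a).carrier ∩ faceAt D π i x,
        q ∈ crossings D ∧ Exposed π (boundaryAt D q) (interiorAt D q) := by
  by_contra! h
  -- Without an exposed crossing in the face, the connected boundary curve can never leave it.
  refine h.1 (IsPreconnected.subset_of_mem_nhdsWithin (D a).isPreconnected_frontier isClosed_closure
    hne fun q hq => ?_)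
  by_contra hn
  obtain ⟨h1, h2⟩ := exposed_of_notMem_nhdsWithin hq.2 hq.1 hn
  exact h.2 q hq h1 h2

/-- A point on the boundary of a face is not visible, so an object of level at least `i` has it on
its boundary. That object is not the one whose boundary enters the face, which makes the point a
crossing. -/
theorem properIntersections_subset :
    properIntersections D (faceAt D π i x) ⊆ {q | q ∈ faceAt D π i x ∧ q ∈ crossings D ∧
      Exposed π (boundaryAt D q) (interiorAt D q)} := by
  rintro q ⟨b, ⟨hqb, hqf⟩, hcl⟩
  have hq : q ∈ faceAt D π i x := isClosed_closure.frontier_subset hqf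
  have hv : q ∉ visiblePart D π i := fun h =>
    hqf.2 (mem_interior_iff_mem_nhds.2 (faceAt_mem_nhds hq h))
  obtain ⟨a, ha, hia⟩ := exists_mem_boundaryAt hq hv
  refine ⟨hq, ⟨b, a, ?_, hqb, mem_boundaryAt.1 ha⟩, exposed_of_le hq ha hia⟩
  rintro rfl
  obtain ⟨y, hyb, hyf⟩ := closure_nonempty_iff.1 ⟨q, hcl⟩
  -- The interior of the face avoids the boundary of its own object, in whose interior it lies, and
  -- of every later object, whose interior the face misses.
  rcases hia.eq_or_lt with h | h
  · have hsub := interior_mono (faceAt_subset_carrier (D := D) (π := π) (i := i) (x := x))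
    rw [h, Equiv.apply_symm_apply] at hsub
    rw [h] at hyf
    exact hyb.2 (hsub hyf)
  · have hd := disjoint_faceAt_interior (D := D) (π := π) (x := x) h
    rw [Equiv.apply_symm_apply] at hd
    have hd' := (hd.mono_left interior_subset).closure_right isOpen_interior
    exact disjoint_left.1 hd' hyf ((D b).subset_closure_interior ((D b).frontier_subset hyb))

/-- A crossing is a vertex of the union of every sample that contains the two crossing objects and
avoids the objects around it. -/
theorem GeneralPosition.mem_unionVertices (hD : GeneralPosition D) (hq : q ∈ crossings D)
    {S : Finset (Fin n)} (hB : boundaryAt D q ⊆ S) (hM : Disjoint S (interiorAt D q)) :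
    q ∈ unionVertices D S := by
  have hO := compl_frontiers_mem_nhds D q
  obtain ⟨a, b, hab, ha, hb⟩ := hq
  have haS := hB (mem_boundaryAt.2 ha)
  have hbS := hB (mem_boundaryAt.2 hb)
  refine ⟨⟨subset_closure (mem_iUnion₂.2 ⟨a, haS, (D a).frontier_subset ha⟩), fun hint => ?_⟩,
    Or.inr ⟨a, haS, b, hbS, hab, ha, hb⟩⟩
  -- Near `q` no object of `S` other than the two crossing ones is present, so a nearby point
  -- outside both is outside the union.
  have hO' : (⋃ e, ⋃ (_ : e ∈ S \ boundaryAt D q), (D e).carrier)ᶜ ∈ 𝓝 q := by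
    refine IsClosed.compl_mem_nhds (isClosed_iUnion_of_finite fun e => isClosed_iUnion_of_finite
      fun _ => (D e).isClosed_carrier) ?_
    simp only [mem_iUnion, not_exists, Finset.mem_sdiff]
    rintro e ⟨heS, heB⟩ he
    rw [mem_boundaryAt, (D e).mem_frontier_iff] at heB
    push Not at heB
    exact Finset.disjoint_left.1 hM heS (mem_interiorAt.2 (heB he))
  obtain ⟨z, ⟨hzU, hzO⟩, hza, hzb⟩ := (hD.cross a b hab q ⟨ha, hb⟩).exists_notMem ha hb
    (Filter.inter_mem (mem_interior_iff_mem_nhds.1 hint) hO')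
  obtain ⟨e, heS, hze⟩ := mem_iUnion₂.1 hzU
  by_cases he : e ∈ boundaryAt D q
  · rcases hD.eq_or_eq hab ha hb (mem_boundaryAt.1 he) with rfl | rfl
    · exact hza hze
    · exact hzb hze
  · refine hzO ?_
    simp only [mem_iUnion]
    exact ⟨e, Finset.mem_sdiff.2 ⟨heS, he⟩, hze⟩

end Stacking

end RandomStacking

/-! ### Charging intersections and conflicts to exposed crossings. -/

namespace RandomStacking

open Set

section Counting

variable {k d n : ℕ} {D : Fin n → Object k d} {π : Equiv.Perm (Fin n)}

open Classical in
/-- The crossings that are exposed in the order `π`. -/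
noncomputable def exposedCrossings (hD : GeneralPosition D) (π : Equiv.Perm (Fin n)) :
    Finset Plane :=
  hD.finite_crossings.toFinset.filter fun q => Exposed π (boundaryAt D q) (interiorAt D q)

theorem mem_exposedCrossings {hD : GeneralPosition D} {q : Plane} :
    q ∈ exposedCrossings hD π ↔
      q ∈ crossings D ∧ Exposed π (boundaryAt D q) (interiorAt D q) := by
  simp [exposedCrossings]

open Classical in
theorem GeneralPosition.tsum_faces_le (hD : GeneralPosition D) {q : Plane} {a : Fin n}
    (ha : q ∈ frontier (D a).carrier) :
    ∑' f : faces D π, (if q ∈ f.1 then (1 : ℝ≥0∞) else 0) ≤ 4 := by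
  have h1 : ∑' f : faces D π, (if q ∈ f.1 then (1 : ℝ≥0∞) else 0)
      = ∑' _ : {f | f ∈ faces D π ∧ q ∈ f}, (1 : ℝ≥0∞) := by
    rw [tsum_subtype (faces D π) fun f => if q ∈ f then (1 : ℝ≥0∞) else 0,
      tsum_subtype {f | f ∈ faces D π ∧ q ∈ f} fun _ => (1 : ℝ≥0∞)]
    refine tsum_congr fun f => ?_
    by_cases hf : f ∈ faces D π <;> by_cases hq : q ∈ f <;> simp [indicator, hf, hq]
  rw [h1, ENNReal.tsum_set_one]
  have := ENat.toENNReal_mono (hD.encard_faces_le (π := π) ha)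
  simpa using this

open Classical in
theorem GeneralPosition.tsum_sum_faces_le {ι : Type*} (hD : GeneralPosition D) (E : Finset ι)
    (p : ι → Plane) (hE : ∀ c ∈ E, ∃ a, p c ∈ frontier (D a).carrier) :
    ∑' f : faces D π, ∑ c ∈ E, (if p c ∈ f.1 then (1 : ℝ≥0∞) else 0) ≤ 4 * E.card := by
  rw [Summable.tsum_finsetSum fun _ _ => ENNReal.summable]
  refine (Finset.sum_le_card_nsmul E _ 4 fun c hc => ?_).trans_eq (by rw [nsmul_eq_mul, mul_comm])
  obtain ⟨a, ha⟩ := hE c hc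
  exact hD.tsum_faces_le ha

theorem exists_mem_frontier_of_mem_exposedCrossings {hD : GeneralPosition D} {q : Plane}
    (hq : q ∈ exposedCrossings hD π) : ∃ a, q ∈ frontier (D a).carrier := by
  obtain ⟨⟨a, b, -, h, -⟩, -⟩ := mem_exposedCrossings.1 hq
  exact ⟨a, h⟩

open Classical in
theorem GeneralPosition.tsum_properIntersections_le (hD : GeneralPosition D) :
    ∑' f : faces D π, ((properIntersections D f.1).encard : ℝ≥0∞)
      ≤ 4 * (exposedCrossings hD π).card := by
  refine le_trans (ENNReal.tsum_le_tsum fun f => ?_) (hD.tsum_sum_faces_le (exposedCrossings hD π) id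
    fun q hq => exists_mem_frontier_of_mem_exposedCrossings hq)
  obtain ⟨f, i, x, hx, rfl⟩ := f
  have hsub : properIntersections D (faceAt D π i x)
      ⊆ ((exposedCrossings hD π).filter (· ∈ faceAt D π i x) : Finset Plane) := by
    intro q hq
    obtain ⟨h1, h2⟩ := properIntersections_subset hq
    rw [Finset.mem_coe, Finset.mem_filter]
    exact ⟨mem_exposedCrossings.2 h2, h1⟩
  have := ENat.toENNReal_mono (encard_le_encard hsub)
  rw [encard_coe_eq_coe_finsetCard, ENat.toENNReal_coe, Finset.card_filter] at this
  refine this.trans_eq ?_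
  push_cast
  rfl

-- A conflict is charged to a fixed point `p a` of the boundary if the face contains all of it, and
-- to an exposed crossing otherwise. Each `p a` lies in at most 4 faces; each crossing serves 2
-- objects in at most 4 faces, whence the 8.
open Classical in
theorem GeneralPosition.tsum_conflictList_le (hD : GeneralPosition D) :
    ∑' f : faces D π, ((conflictList D f.1).encard : ℝ≥0∞)
      ≤ 4 * n + 8 * (exposedCrossings hD π).card := by
  choose p hp using fun a => (D a).frontier_nonempty
  have hbound : ∀ f : faces D π, ((conflictList D f.1).encard : ℝ≥0∞)
      ≤ ∑ a : Fin n, (if p a ∈ f.1 then (1 : ℝ≥0∞) else 0)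
        + 2 * ∑ q ∈ exposedCrossings hD π, (if q ∈ f.1 then (1 : ℝ≥0∞) else 0) := by
    rintro ⟨f, i, x, hx, rfl⟩
    have hsub : conflictList D (faceAt D π i x)
        ⊆ ((Finset.univ.filter fun a => p a ∈ faceAt D π i x) ∪
          ((exposedCrossings hD π).filter (· ∈ faceAt D π i x)).biUnion (boundaryAt D) :
            Finset (Fin n)) := by
      intro a ha
      rw [Finset.mem_coe, Finset.mem_union]
      rcases subset_or_exists_exposed ha with h | ⟨q, hq, h⟩
      · exact Or.inl (Finset.mem_filter.2 ⟨Finset.mem_univ _, h (hp a)⟩)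
      · exact Or.inr (Finset.mem_biUnion.2 ⟨q, Finset.mem_filter.2
          ⟨mem_exposedCrossings.2 h, hq.2⟩, mem_boundaryAt.2 hq.1⟩)
    have hcard : ((Finset.univ.filter fun a => p a ∈ faceAt D π i x) ∪
          ((exposedCrossings hD π).filter (· ∈ faceAt D π i x)).biUnion (boundaryAt D)).card
        ≤ (Finset.univ.filter fun a => p a ∈ faceAt D π i x).card
          + 2 * ((exposedCrossings hD π).filter (· ∈ faceAt D π i x)).card := by
      refine (Finset.card_union_le _ _).trans (Nat.add_le_add_left ?_ _)
      rw [mul_comm]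
      refine Finset.card_biUnion_le_card_mul _ _ _ fun q hq => (hD.card_boundaryAt ?_).le
      exact (mem_exposedCrossings.1 (Finset.mem_filter.1 hq).1).1
    have h1 := ENat.toENNReal_mono (encard_le_encard hsub)
    rw [encard_coe_eq_coe_finsetCard, ENat.toENNReal_coe] at h1
    refine h1.trans ((Nat.cast_le.2 hcard).trans_eq ?_)
    rw [Finset.card_filter, Finset.card_filter]
    push_cast
    rfl
  refine (ENNReal.tsum_le_tsum hbound).trans ?_
  rw [ENNReal.tsum_add, ENNReal.tsum_mul_left]
  refine add_le_add ?_ ?_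
  · have := hD.tsum_sum_faces_le (π := π) Finset.univ p fun a _ => ⟨a, hp a⟩
    rwa [Finset.card_univ, Fintype.card_fin] at this
  · have := hD.tsum_sum_faces_le (π := π) (exposedCrossings hD π) id
      fun q hq => exists_mem_frontier_of_mem_exposedCrossings hq
    calc _ ≤ 2 * (4 * ((exposedCrossings hD π).card : ℝ≥0∞)) := by gcongr; exact this
      _ = _ := by rw [← mul_assoc]; norm_num

/-- A single object has at least one vertex. With superadditivity this gives m ≤ U(m), which
supplies nonnegativity of `U` and absorbs the linear term of the conflict bound. -/
theorem one_le_of_hasUnionComplexity {U : ℕ → ℝ} (hU : HasUnionComplexity D U) (a : Fin n) :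
    1 ≤ U 1 := by
  obtain ⟨q, hq⟩ := (D a).frontier_nonempty
  rw [(D a).frontier_eq] at hq
  obtain ⟨c, -⟩ := mem_iUnion.1 hq
  have hunion : unionOf D {a} = (D a).carrier := by simp [unionOf]
  have hv : ((D a).arc c).param 0 ∈ unionVertices D {a} := by
    refine ⟨?_, Or.inl ⟨a, Finset.mem_singleton_self a, mem_iUnion.2 ⟨c, Or.inl rfl⟩⟩⟩
    rw [hunion, (D a).frontier_eq]
    exact mem_iUnion.2 ⟨c, mem_range_self 0⟩
  have h1 : 1 ≤ unionComplexity D {a} :=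
    (one_le_encard_iff_nonempty.2 ⟨_, hv⟩).trans le_self_add
  have h2 := (ENat.toENNReal_mono h1).trans (hU {a})
  rw [Finset.card_singleton, ENat.toENNReal_one, ENNReal.one_le_ofReal] at h2
  exact h2

open Classical in
theorem GeneralPosition.card_active_le (hD : GeneralPosition D) {U : ℕ → ℝ}
    (hU : HasUnionComplexity D U) {S : Finset (Fin n)} (hS : 0 ≤ U S.card) :
    ((hD.finite_crossings.toFinset.filter fun q =>
      S ∈ Finset.Icc (boundaryAt D q) (interiorAt D q)ᶜ).card : ℝ) ≤ U S.card := by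
  have hsub : ((hD.finite_crossings.toFinset.filter fun q =>
      S ∈ Finset.Icc (boundaryAt D q) (interiorAt D q)ᶜ : Finset Plane) : Set Plane)
      ⊆ unionVertices D S := by
    intro q hq
    rw [Finset.mem_coe, Finset.mem_filter, Set.Finite.mem_toFinset, Finset.mem_Icc] at hq
    exact hD.mem_unionVertices hq.1 hq.2.1 (Finset.subset_compl_iff_disjoint_right.1 hq.2.2)
  have h1 := (ENat.toENNReal_mono ((encard_le_encard hsub).trans le_self_add)).trans (hU S)
  rw [encard_coe_eq_coe_finsetCard, ENat.toENNReal_coe] at h1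
  rwa [← ENNReal.ofReal_natCast, ENNReal.ofReal_le_ofReal_iff hS] at h1

theorem expectation_le {X : Equiv.Perm (Fin n) → ℝ≥0∞} {Y : Equiv.Perm (Fin n) → ℕ} {r : ℝ}
    (hX : ∀ π, X π ≤ Y π) (hY : (∑ π, Y π : ℕ) ≤ n.factorial * r) :
    expectation X ≤ ENNReal.ofReal r := by
  have hn : (0 : ℝ) < n.factorial := by exact_mod_cast n.factorial_pos
  refine ENNReal.div_le_of_le_mul ?_
  calc ∑ π, X π ≤ ∑ π, (Y π : ℝ≥0∞) := Finset.sum_le_sum fun π _ => hX π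
    _ = ENNReal.ofReal (∑ π, Y π : ℕ) := by rw [ENNReal.ofReal_natCast, Nat.cast_sum]
    _ ≤ ENNReal.ofReal (n.factorial * r) := ENNReal.ofReal_le_ofReal hY
    _ = _ := by rw [mul_comm, ENNReal.ofReal_mul' hn.le, ENNReal.ofReal_natCast]

end Counting

end RandomStacking

/-! ### The main theorem. -/

open RandomStacking in
theorem mainTheorem8 (k d : ℕ) :
    ∃ C : ℝ, 0 < C ∧
      ∀ (n : ℕ), 2 ≤ n →
      ∀ (D : Fin n → RandomStacking.Object k d) (U : ℕ → ℝ),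
        RandomStacking.GeneralPosition D →
        RandomStacking.HasUnionComplexity D U →
        (∀ a b : ℕ, 1 ≤ a → 1 ≤ b → U a + U b ≤ U (a + b)) →
        RandomStacking.expectation (fun π =>
            ∑' f : RandomStacking.faces D π,
              ((RandomStacking.properIntersections D f.1).encard : ℝ≥0∞))
          ≤ ENNReal.ofReal (C * (U n * Real.log n)) ∧
        RandomStacking.expectation (fun π =>
            ∑' f : RandomStacking.faces D π,
              ((RandomStacking.conflictList D f.1).encard : ℝ≥0∞))
          ≤ ENNReal.ofReal (C * (U n * Real.log n)) := by
  -- With L = U(n) log n, n ≤ 2L and at most 12L exposed crossings expected, conflicts cost 4·2L +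
  -- 8·12L = 104L; proper intersections cost 4·12L = 48L.
  refine ⟨104, by norm_num, fun n hn D U hD hU hsup => ?_⟩
  have h1 : 1 ≤ U 1 := one_le_of_hasUnionComplexity hU ⟨0, by omega⟩
  have hUn : (n : ℝ) ≤ U n := le_of_superadditive hsup h1 (by omega)
  have hlog : (1 / 2 : ℝ) ≤ Real.log n := by
    have := Real.log_two_gt_d9
    have : Real.log 2 ≤ Real.log n := Real.log_le_log (by norm_num) (by exact_mod_cast hn)
    linarith
  have hn0 : (0 : ℝ) ≤ n := by positivity
  have hUL : (n : ℝ) ≤ 2 * (U n * Real.log n) := by nlinarith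
  have hfac : (0 : ℝ) < n.factorial := by exact_mod_cast n.factorial_pos
  have hE : (∑ π, (exposedCrossings hD π).card : ℕ) ≤ n.factorial * (12 * (U n * Real.log n)) := by
    classical
    have h := sum_card_exposed_le hsup h1 hn hD.finite_crossings.toFinset (boundaryAt D)
      (interiorAt D) (fun q hq => hD.card_boundaryAt (by simpa using hq))
      (fun q _ => disjoint_boundaryAt_interiorAt) fun S hS => by
        convert hD.card_active_le hU (S := S) (le_trans (by positivity)
          (le_of_superadditive hsup h1 (by omega : 1 ≤ S.card)))
    convert h using 6
    ext q
    simp [mem_exposedCrossings]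
  constructor
  · refine expectation_le (Y := fun π => 4 * (exposedCrossings hD π).card) (fun π => ?_) ?_
    · exact_mod_cast hD.tsum_properIntersections_le
    · rw [← Finset.mul_sum]
      push_cast at hE ⊢
      nlinarith
  · refine expectation_le (Y := fun π => 4 * n + 8 * (exposedCrossings hD π).card) (fun π => ?_) ?_
    · exact_mod_cast hD.tsum_conflictList_le
    · rw [Finset.sum_add_distrib, Finset.sum_const, ← Finset.mul_sum, Finset.card_univ,
        Fintype.card_perm, Fintype.card_fin, smul_eq_mul, Nat.cast_add, Nat.cast_mul, Nat.cast_mul,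
        Nat.cast_mul]
      have := mul_le_mul_of_nonneg_left hUL hfac.le
      push_cast at hE ⊢
      linarith
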